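/- Let $X=\begin{bmatrix}0&1\\1&0\end{bmatrix}$ and $H=\frac1{\sqrt2}\begin{bmatrix}1&1\\1&-1\end{bmatrix}$ be the NOT and Hadamard gates, and let $CX=I_2\oplus X$, $CCX=I_6\oplus X$ and $CH=I_2\oplus H$. A circuit on $N$ qubits over $\{X,CX,CCX,H,CH\}$ is built from these gates, each applied to distinct qubits, by composition and tensor product (with identity wires); we identify it with the $2^N\times 2^N$ matrix that it computes. For $n,m\ge 0$, a $2^n\times 2^n$ complex matrix $V$ is exactly represented by a circuit $D$ on $n+m$ qubits using $m$ (clean) ancillas if $D\,|\psi\rangle|0\rangle^{\otimes m}=(V|\psi\rangle)|0\rangle^{\otimes m}$ for every $n$-qubit state $|\psi\rangle$. Let $U_{2^n}(\mathbb{Z}[1/\sqrt2])$ be the group of $2^n\times 2^n$ unitary matrices with all entries in the ring $\mathbb{Z}[1/\sqrt2]$. Let $n\ge 0$ and let $V$ be a $2^n\times 2^n$ complex matrix. Then $V$ can be exactly represented by a circuit over $\{X,CX,CCX,H,CH\}$ using some finite number of ancillas if and only if $V\in U_{2^n}(\mathbb{Z}[1/\sqrt2])$. Moreover, every $V\in U_{2^n}(\mathbb{Z}[1/\sqrt2])$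 is exactly represented by such a circuit using a single ancilla. -/

import Mathlib

namespace QCirc

noncomputable section

/-- Computational basis labels of `n` qubits: bit strings of length `n`. -/
abbrev Bits (n : ℕ) : Type := Fin n → Fin 2

/-- Complex `2^n × 2^n` matrices, rows and columns labelled by the bit strings of length `n`. -/
abbrev Op (n : ℕ) : Type := Matrix (Bits n) (Bits n) ℂ

/-- The first `a` bits of a bit string of length `a + b`. -/
def left {a b : ℕ} (x : Bits (a + b)) : Bits a := fun i => x (Fin.castAdd b i)

/-- The last `b` bits of a bit string of length `a + b`. -/
def right {a b : ℕ} (x : Bits (a + b)) : Bits b := fun i => x (Fin.natAdd a i)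

/-- Tensor product of operators. -/
def tensorOp {a b : ℕ} (A : Op a) (B : Op b) : Op (a + b) :=
  fun x y => A (left x) (left y) * B (right x) (right y)

/-- Tensor product of vectors. -/
def tensorVec {a b : ℕ} (v : Bits a → ℂ) (w : Bits b → ℂ) : Bits (a + b) → ℂ :=
  fun x => v (left x) * w (right x)

/-- The state `|0⟩^{⊗ m}`. -/
def ketZero (m : ℕ) : Bits m → ℂ := Pi.single 0 1

/-- An `n`-qubit (pure) state: a vector of norm one. -/
def IsState {n : ℕ} (ψ : Bits n → ℂ) : Prop := ∑ x, ‖ψ x‖ ^ 2 = 1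

/-- A `2 × 2` matrix as a one-qubit gate. -/
def single (A : Matrix (Fin 2) (Fin 2) ℂ) : Op 1 := fun x y => A (x 0) (y 0)

/-- The controlled gate `I ⊕ U = |0⟩⟨0| ⊗ I + |1⟩⟨1| ⊗ U`; the control is the first qubit. -/
def ctrl {k : ℕ} (U : Op k) : Op (k + 1) := fun x y =>
  if x 0 = y 0 then
    (if x 0 = 0 then (1 : Op k) else U) (Fin.tail x) (Fin.tail y)
  else 0

def gateX : Op 1 := single !![0, 1; 1, 0]

def gateH : Op 1 := single ((1 / (Real.sqrt 2 : ℂ)) • !![1, 1; 1, -1])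

def gateCX : Op 2 := ctrl gateX

def gateCCX : Op 3 := ctrl (ctrl gateX)

def gateCH : Op 2 := ctrl gateH

/-- A gate set: a set of matrices, each with its number of qubits. -/
abbrev GateSet : Type := Set (Σ k : ℕ, Op k)

/-- The gate set `{X, CX, CCX, H, CH}`. -/
def realGates : GateSet :=
  {⟨1, gateX⟩, ⟨2, gateCX⟩, ⟨3, gateCCX⟩, ⟨1, gateH⟩, ⟨2, gateCH⟩}

/-- The action on `n` qubits of a `k`-qubit gate whose `j`-th input is the wire `w j`:
the gate acts on the selected wires, the identity on all the others. -/
def place {k n : ℕ} (U : Op k) (w : Fin k ↪ Fin n) : Op n := by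
  classical
  exact fun x y =>
    if ∀ i, i ∉ Set.range w → x i = y i then U (fun j => x (w j)) (fun j => y (w j)) else 0

/-- Circuits on `n` wires over the gate set `G`, built from gates of `G` (each one applied to
distinct wires) by composition and tensor product. -/
inductive Circuit (G : GateSet) : ℕ → Type
  | id (n : ℕ) : Circuit G n
  | gate {k n : ℕ} (U : Op k) (hU : (⟨k, U⟩ : Σ k : ℕ, Op k) ∈ G) (w : Fin k ↪ Fin n) : Circuit G n
  | comp {n : ℕ} (C D : Circuit G n) : Circuit G n
  | tensor {a b : ℕ} (C : Circuit G a) (D : Circuit G b) : Circuit G (a + b)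

/-- The operator computed by a circuit; in `comp C D` the circuit `C` is run first. -/
def Circuit.eval {G : GateSet} : {n : ℕ} → Circuit G n → Op n
  | _, .id _ => 1
  | _, .gate U _ w => place U w
  | _, .comp C D => D.eval * C.eval
  | _, .tensor C D => tensorOp C.eval D.eval

/-- The circuit `D` exactly represents `V` using `m` clean ancillas:
`D |ψ⟩|0⟩^{⊗ m} = (V |ψ⟩)|0⟩^{⊗ m}` for every `n`-qubit state `|ψ⟩`. -/
def Represents {G : GateSet} {n m : ℕ} (D : Circuit G (n + m)) (V : Op n) : Prop :=
  ∀ ψ : Bits n → ℂ, IsState ψ →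
    D.eval.mulVec (tensorVec ψ (ketZero m)) = tensorVec (V.mulVec ψ) (ketZero m)

/-- `V` is exactly represented by some circuit over `G` using `m` clean ancillas. -/
def RepresentableWith (G : GateSet) (m : ℕ) {n : ℕ} (V : Op n) : Prop :=
  ∃ D : Circuit G (n + m), Represents D V

/-- `V` is exactly representable by an `n`-qubit circuit over `G`, ancillas being allowed. -/
def Representable (G : GateSet) {n : ℕ} (V : Op n) : Prop :=
  ∃ m : ℕ, RepresentableWith G m V

/-- The ring `ℤ[1/√2]`, as a subring of `ℂ`. -/
def ringZInvSqrtTwo : Subalgebra ℤ ℂ := Algebra.adjoin ℤ {1 / (Real.sqrt 2 : ℂ)}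

/-- `U_{2^n}(R)`: the unitary `2^n × 2^n` matrices with all entries in `R`. -/
def unitaryOver (R : Subalgebra ℤ ℂ) (n : ℕ) : Set (Op n) :=
  {V | V ∈ Matrix.unitaryGroup (Bits n) ℂ ∧ ∀ x y, V x y ∈ R}

end

end QCirc

namespace QCirc

noncomputable section

open Matrix

local notation "ω₂" => ((Real.sqrt 2 : ℝ) : ℂ)

section Synthesis

/-! ### Arithmetic of `ℤ[1/√2]` -/

/-! Circuits compute unitaries over ℤ[1/√2] because the gates do and placing, composing and
tensoring preserve this. Since ψ ↦ ψ ⊗ |0…0⟩ is an isometry, a represented V inherits unitarity, and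
its entries are entries of the circuit operator (`Representable.mem_unitaryRing`).

For the converse, V is reduced column by column. A unit column has entries (p i + q i √2)/√2^k.
Comparing coefficients of 1 and √2 in the norm equation gives ∑ (p² + 2q²) = 2^k and ∑ pq = 0. If k
> 0 and some p i is odd, parity yields two indices with odd p and q of equal parity. A Hadamard on
this pair makes both p's even. Once all p are even, a factor √2 cancels and k drops; at k = 0 the
column is a signed basis vector. So two-level Hadamards, signs and transpositions generate the whole
group (`exists_mulVec_eq_single`, `unitaryRing_le`).

These generators need only one ancilla. As a borrowed wire it gives NOT with any number of controls,
by a commutator (`flip_commutator`); as a clean wire it stores the conjunction of the controls and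
so gives multiply controlled H. With all other wires as controls, these gates act on one edge of the
hypercube of bit strings. Connectedness gives all permutations of basis states, and conjugation by
them gives a Hadamard on any pair. Signs come from HXH = Z, or, when n = 0, from a gate sequence
acting on the ancilla as −1 at |0⟩. -/

theorem sqrtTwo_mul_self : ω₂ * ω₂ = 2 := by
  rw [← Complex.ofReal_mul, Real.mul_self_sqrt (by norm_num)]
  norm_num

theorem sqrtTwo_ne_zero : ω₂ ≠ 0 := by
  intro h
  have := sqrtTwo_mul_self
  rw [h] at this
  norm_num at this

theorem star_sqrtTwo : star ω₂ = ω₂ := Complex.conj_ofReal _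

theorem invSqrtTwo_mem_ring : 1 / ω₂ ∈ ringZInvSqrtTwo :=
  Algebra.subset_adjoin rfl

/-- Elements of `ℤ[1/√2]` are of the form `(a + b√2) / √2^k`. -/
theorem exists_sqrtTwo_pow_mul {r : ℂ} (hr : r ∈ ringZInvSqrtTwo) :
    ∃ (k : ℕ) (a b : ℤ), r * ω₂ ^ k = a + b * ω₂ := by
  have h2 := sqrtTwo_mul_self
  -- Exponents can be raised freely, since (a + b√2)√2 = 2b + a√2; this provides a common exponent
  -- for sums.
  have lift : ∀ (r : ℂ) (k : ℕ), (∃ a b : ℤ, r * ω₂ ^ k = a + b * ω₂) → ∀ l,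
      ∃ a b : ℤ, r * ω₂ ^ (k + l) = a + b * ω₂ := by
    intro r k h l
    induction l with
    | zero => exact h
    | succ l ih =>
      obtain ⟨a, b, hab⟩ := ih
      refine ⟨2 * b, a, ?_⟩
      rw [← add_assoc, pow_succ, ← mul_assoc, hab]
      push_cast
      linear_combination (b : ℂ) * h2
  refine Algebra.adjoin_induction (p := fun r _ => ∃ (k : ℕ) (a b : ℤ), r * ω₂ ^ k = a + b * ω₂)
    ?_ ?_ ?_ ?_ hr
  · rintro x rfl
    exact ⟨1, 1, 0, by simp⟩
  · intro m
    exact ⟨0, m, 0, by simp⟩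
  · rintro x y - - ⟨k, hx⟩ ⟨l, hy⟩
    obtain ⟨a, b, hab⟩ := lift x k hx l
    obtain ⟨c, d, hcd⟩ := lift y l hy k
    refine ⟨k + l, a + c, b + d, ?_⟩
    rw [add_comm l k] at hcd
    push_cast
    linear_combination hab + hcd
  · rintro x y - - ⟨k, a, b, hx⟩ ⟨l, c, d, hy⟩
    refine ⟨k + l, a * c + 2 * b * d, a * d + b * c, ?_⟩
    rw [pow_add]
    push_cast
    linear_combination (y * ω₂ ^ l) * hx + (a + b * ω₂) * hy + (b : ℂ) * d * h2

theorem star_eq_of_mem_ring {r : ℂ} (hr : r ∈ ringZInvSqrtTwo) : star r = r := by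
  obtain ⟨k, a, b, h⟩ := exists_sqrtTwo_pow_mul hr
  have h' := congrArg star h
  simp only [star_mul', star_pow, star_add, star_sqrtTwo, star_intCast] at h'
  exact mul_right_cancel₀ (pow_ne_zero k sqrtTwo_ne_zero) (h'.trans h.symm)

theorem exists_common_sqrtTwo_pow_mul {ι : Type*} [Finite ι] {v : ι → ℂ}
    (hv : ∀ i, v i ∈ ringZInvSqrtTwo) :
    ∃ (k : ℕ) (p q : ι → ℤ), ∀ i, v i * ω₂ ^ k = p i + q i * ω₂ := by
  classical
  cases nonempty_fintype ι
  choose k a b h using fun i => exists_sqrtTwo_pow_mul (hv i)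
  have key : ∀ i, ∃ p q : ℤ, v i * ω₂ ^ (∑ j, k j) = p + q * ω₂ := by
    intro i
    rw [← Finset.add_sum_erase _ _ (Finset.mem_univ i), pow_add, ← mul_assoc, h]
    induction ∑ j ∈ Finset.univ.erase i, k j with
    | zero => exact ⟨a i, b i, by simp⟩
    | succ l ih =>
      obtain ⟨p, q, hpq⟩ := ih
      refine ⟨2 * q, p, ?_⟩
      rw [pow_succ, ← mul_assoc, hpq]
      push_cast
      linear_combination (q : ℂ) * sqrtTwo_mul_self
  choose p q hpq using key
  exact ⟨_, p, q, hpq⟩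

/-- Irrationality of √2: one equation in ℤ[√2] splits into two integer equations. -/
theorem int_add_mul_sqrtTwo_eq {a b c : ℤ} (h : (a : ℂ) + b * ω₂ = c) : a = c ∧ b = 0 := by
  have h' : (a : ℝ) + b * Real.sqrt 2 = c := by exact_mod_cast h
  have hb : b = 0 := by
    by_contra hb
    have hb' : (b : ℝ) ≠ 0 := by exact_mod_cast hb
    refine irrational_sqrt_two ⟨((c - a : ℤ) : ℚ) / (b : ℚ), ?_⟩
    push_cast
    rw [div_eq_iff hb']
    linarith
  subst hb
  exact ⟨by exact_mod_cast (by simpa using h' : (a : ℝ) = c), rfl⟩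

theorem even_sum_iff_even_card_filter_odd {ι : Type*} (s : Finset ι) (f : ι → ℤ) :
    Even (∑ i ∈ s, f i) ↔ Even (s.filter fun i => Odd (f i)).card := by
  classical
  induction s using Finset.induction_on with
  | empty => simp
  | insert a s ha ih =>
    rw [Finset.sum_insert ha, Finset.filter_insert, Int.even_add, ih]
    split_ifs with h
    · rw [Finset.card_insert_of_notMem (by simp [ha]), Nat.even_add_one, ← Int.not_odd_iff_even]
      tauto
    · rw [Int.not_odd_iff_even] at h
      tauto

/-! ### Parity of the numerators of a unit vector -/

variable {ι : Type*} [Fintype ι]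

/-- The entries are real, so the norm condition reads ∑ (p i + q i √2)² = 2^k; the two conclusions
are its coefficients of 1 and √2. -/
theorem sum_sq_of_unit {v : ι → ℂ} {k : ℕ} {p q : ι → ℤ}
    (hv : ∀ i, v i * ω₂ ^ k = p i + q i * ω₂) (h1 : star v ⬝ᵥ v = 1) :
    ∑ i, (p i ^ 2 + 2 * q i ^ 2) = 2 ^ k ∧ ∑ i, p i * q i = 0 := by
  have hreal : ∀ i, star (v i) = v i := by
    intro i
    have h' := congrArg star (hv i)
    simp only [star_mul', star_pow, star_add, star_sqrtTwo, star_intCast] at h'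
    exact mul_right_cancel₀ (pow_ne_zero k sqrtTwo_ne_zero) (h'.trans (hv i).symm)
  have hsum : ∑ i, ((p i : ℂ) + q i * ω₂) ^ 2 = 2 ^ k := by
    have : ∑ i, (v i * ω₂ ^ k) ^ 2 = 2 ^ k * (star v ⬝ᵥ v) := by
      simp only [dotProduct, Pi.star_apply, hreal, Finset.mul_sum]
      refine Finset.sum_congr rfl fun i _ => ?_
      rw [← sqrtTwo_mul_self]
      ring
    rw [h1, mul_one] at this
    rw [← this]
    exact Finset.sum_congr rfl fun i _ => by rw [hv]
  have h3 := @int_add_mul_sqrtTwo_eq (∑ i, (p i ^ 2 + 2 * q i ^ 2)) (2 * ∑ i, p i * q i) (2 ^ k) (by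
    push_cast
    rw [← hsum, Finset.mul_sum, Finset.sum_mul, ← Finset.sum_add_distrib]
    refine Finset.sum_congr rfl fun i _ => ?_
    linear_combination (-(q i : ℂ) ^ 2) * sqrtTwo_mul_self)
  exact ⟨h3.1, by linarith [h3.2]⟩

/-- Among odd residues, those congruent modulo `2` come in pairs. -/
theorem exists_pair_of_odd {p q : ι → ℤ} {k : ℕ}
    (hsq : ∑ i, (p i ^ 2 + 2 * q i ^ 2) = 2 ^ (k + 1)) (hpq : ∑ i, p i * q i = 0)
    {c : ι} (hc : Odd (p c)) :
    ∃ a b, a ≠ b ∧ Odd (p a) ∧ Odd (p b) ∧ (Odd (q a) ↔ Odd (q b)) := by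
  -- An even sum has an even number of odd terms, so one odd term forces a second.
  have key : ∀ f : ι → ℤ, Even (∑ i, f i) → (∃ i, Odd (f i)) →
      ∃ a b, a ≠ b ∧ Odd (f a) ∧ Odd (f b) := by
    rintro f hf ⟨i, hi⟩
    have hcard := (even_sum_iff_even_card_filter_odd _ f).1 hf
    have : 1 < (Finset.univ.filter fun i => Odd (f i)).card := by
      have h0 : 0 < (Finset.univ.filter fun i => Odd (f i)).card :=
        Finset.card_pos.2 ⟨i, by simpa using hi⟩
      obtain ⟨m, hm⟩ := hcard
      omega
    obtain ⟨a, ha, b, hb, hab⟩ := Finset.one_lt_card.1 this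
    exact ⟨a, b, hab, by simpa using ha, by simpa using hb⟩
  -- If some product is odd, ∑ pq = 0 supplies two indices with p and q both odd. Otherwise odd p
  -- forces even q, and the evenness of ∑ p² supplies the pair.
  by_cases h : ∃ i, Odd (p i * q i)
  · obtain ⟨a, b, hab, ha, hb⟩ := key _ (by rw [hpq]; exact Even.zero) h
    rw [Int.odd_mul] at ha hb
    exact ⟨a, b, hab, ha.1, hb.1, iff_of_true ha.2 hb.2⟩
  · push Not at h
    have hsq' : ∑ i, p i ^ 2 = 2 * (2 ^ k - ∑ i, q i ^ 2) := by
      rw [Finset.sum_add_distrib, ← Finset.mul_sum, pow_succ] at hsq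
      linarith
    obtain ⟨a, b, hab, ha, hb⟩ := key (fun i => p i ^ 2) (by rw [hsq']; exact even_two_mul _)
      ⟨c, hc.pow⟩
    simp only [Int.odd_pow, OfNat.ofNat_ne_zero, or_false] at ha hb
    have := h a
    have := h b
    rw [Int.odd_mul] at *
    exact ⟨a, b, hab, ha, hb, by tauto⟩

theorem matrix_ext_mulVec {M N : Matrix ι ι ℂ} (h : ∀ v x, (M *ᵥ v) x = (N *ᵥ v) x) : M = N :=
  mulVec_injective (funext fun v => funext (h v))

/-! ### One- and two-level matrices -/

variable [DecidableEq ι]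

/-- The Hadamard gate acting on the coordinates `a` and `b`. -/
def hadamardAt (a b : ι) : Matrix ι ι ℂ := fun x y =>
  if x = a then (if y = a then 1 / ω₂ else if y = b then 1 / ω₂ else 0)
  else if x = b then (if y = a then 1 / ω₂ else if y = b then -(1 / ω₂) else 0)
  else if x = y then 1 else 0

/-- The diagonal matrix with a sign at the coordinate `a`. -/
def signAt (a : ι) : Matrix ι ι ℂ := diagonal fun i => if i = a then -1 else 1

theorem hadamardAt_mulVec {a b : ι} (hab : a ≠ b) (v : ι → ℂ) (x : ι) :
    (hadamardAt a b *ᵥ v) x = if x = a then (v a + v b) / ω₂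
      else if x = b then (v a - v b) / ω₂ else v x := by
  have hsplit : ∀ c d : ℂ, (∑ y, (if y = a then c else if y = b then d else 0) * v y)
      = c * v a + d * v b := by
    intro c d
    rw [← Finset.add_sum_erase _ _ (Finset.mem_univ a),
      ← Finset.add_sum_erase _ _ (Finset.mem_erase.2 ⟨hab.symm, Finset.mem_univ b⟩),
      Finset.sum_eq_zero]
    · simp [hab.symm]
    · intro y hy
      simp only [Finset.mem_erase] at hy
      simp [hy.1, hy.2.1]
  simp only [mulVec, dotProduct, hadamardAt]
  split_ifs with h1 h2
  · rw [hsplit]; ring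
  · rw [hsplit]; ring
  · simp

theorem signAt_mulVec (a : ι) (v : ι → ℂ) (x : ι) :
    (signAt a *ᵥ v) x = if x = a then -v x else v x := by
  rw [signAt, mulVec_diagonal]
  split_ifs <;> simp

/-- Unitary matrices with entries in `ℤ[1/√2]`. -/
def unitaryRing (ι : Type*) [Fintype ι] [DecidableEq ι] : Submonoid (Matrix ι ι ℂ) where
  carrier := {V | V ∈ unitaryGroup ι ℂ ∧ ∀ x y, V x y ∈ ringZInvSqrtTwo}
  one_mem' := ⟨one_mem _, fun x y => by
    rw [one_apply]
    split_ifs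
    exacts [one_mem _, zero_mem _]⟩
  mul_mem' hA hB := ⟨mul_mem hA.1 hB.1, fun x y => by
    rw [mul_apply]
    exact sum_mem fun z _ => mul_mem (hA.2 _ _) (hB.2 _ _)⟩

theorem dotProduct_star_mulVec {V : Matrix ι ι ℂ} (hV : V ∈ unitaryGroup ι ℂ) (v w : ι → ℂ) :
    star (V *ᵥ v) ⬝ᵥ (V *ᵥ w) = star v ⬝ᵥ w := by
  rw [star_mulVec, dotProduct_mulVec, vecMul_vecMul, ← star_eq_conjTranspose,
    mem_unitaryGroup_iff'.1 hV, vecMul_one]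

theorem star_mem_unitaryRing {V : Matrix ι ι ℂ} (hV : V ∈ unitaryRing ι) :
    star V ∈ unitaryRing ι :=
  ⟨mem_unitaryGroup_iff.2 (by rw [star_star]; exact mem_unitaryGroup_iff'.1 hV.1), fun x y => by
    rw [star_apply, star_eq_of_mem_ring (hV.2 _ _)]
    exact hV.2 _ _⟩

theorem mem_unitaryRing_of_mul_self {V : Matrix ι ι ℂ} (hs : star V = V) (h1 : V * V = 1)
    (h : ∀ x y, V x y ∈ ringZInvSqrtTwo) : V ∈ unitaryRing ι :=
  ⟨mem_unitaryGroup_iff.2 (by rw [hs, h1]), h⟩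

theorem signAt_mem (a : ι) : signAt a ∈ unitaryRing ι := by
  refine mem_unitaryRing_of_mul_self ?_ ?_ ?_
  · ext x y
    by_cases h : x = y
    · subst h; simp only [star_apply, signAt, diagonal_apply_eq]; split_ifs <;> simp
    · simp [star_apply, signAt, diagonal_apply_ne _ h, diagonal_apply_ne _ (Ne.symm h)]
  · refine matrix_ext_mulVec fun v x => ?_
    rw [← mulVec_mulVec, signAt_mulVec, signAt_mulVec, one_mulVec]
    split_ifs <;> simp
  · intro x y
    rw [signAt, diagonal_apply]
    split_ifs
    exacts [neg_mem (one_mem _), one_mem _, zero_mem _]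

theorem hadamardAt_mem {a b : ι} (hab : a ≠ b) : hadamardAt a b ∈ unitaryRing ι := by
  refine mem_unitaryRing_of_mul_self ?_ ?_ ?_
  · ext x y
    have hs : star (1 / ω₂) = 1 / ω₂ := star_eq_of_mem_ring invSqrtTwo_mem_ring
    simp only [star_apply, hadamardAt]
    generalize 1 / ω₂ = s at hs
    simp only [apply_ite star, star_neg, star_one, star_zero, hs]
    grind
  · refine matrix_ext_mulVec fun v x => ?_
    have h2 := sqrtTwo_mul_self
    have h0 := sqrtTwo_ne_zero
    rw [← mulVec_mulVec, hadamardAt_mulVec hab, one_mulVec]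
    simp only [hadamardAt_mulVec hab, if_true, if_neg hab.symm]
    split_ifs with h1 h2
    · subst h1; field_simp; rw [sq, sqrtTwo_mul_self]; ring
    · subst h2; field_simp; rw [sq, sqrtTwo_mul_self]; ring
    · rfl
  · intro x y
    have := invSqrtTwo_mem_ring
    rw [hadamardAt]
    split_ifs <;> first | assumption | exact zero_mem _ | exact one_mem _ | exact neg_mem this

theorem permMatrix_mem (σ : Equiv.Perm ι) : σ.permMatrix ℂ ∈ unitaryRing ι := by
  refine ⟨mem_unitaryGroup_iff.2 ?_, fun x y => ?_⟩
  · rw [star_eq_conjTranspose, conjTranspose_permMatrix, ← permMatrix_mul]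
    simp
  · rw [Equiv.Perm.permMatrix, PEquiv.toMatrix_apply]
    split_ifs
    exacts [one_mem _, zero_mem _]

/-! ### Exact synthesis by one- and two-level matrices -/

theorem mulVec_mem_ring {V : Matrix ι ι ℂ} (hV : V ∈ unitaryRing ι) {v : ι → ℂ}
    (hv : ∀ i, v i ∈ ringZInvSqrtTwo) (i : ι) : (V *ᵥ v) i ∈ ringZInvSqrtTwo :=
  sum_mem fun _ _ => mul_mem (hV.2 _ _) (hv _)

/-- Bottom of the descent, k = 0: nonnegative integers summing to 1 have a single nonzero term, and
the factor 2 excludes the q's. -/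
theorem unit_of_sum_eq_one {p q : ι → ℤ} (h : ∑ i, (p i ^ 2 + 2 * q i ^ 2) = 1) :
    ∃ l, (p l = 1 ∨ p l = -1) ∧ (∀ i, i ≠ l → p i = 0) ∧ ∀ i, q i = 0 := by
  have hq : ∀ i, q i = 0 := by
    intro i
    by_contra hq
    have h1 : p i ^ 2 + 2 * q i ^ 2 ≤ 1 := h ▸
      Finset.single_le_sum (f := fun i => p i ^ 2 + 2 * q i ^ 2) (fun i _ => by positivity)
        (Finset.mem_univ i)
    have : 0 < q i ^ 2 := by positivity
    nlinarith [sq_nonneg (p i)]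
  simp only [hq, ne_eq, OfNat.ofNat_ne_zero, not_false_eq_true, zero_pow, mul_zero,
    add_zero] at h
  obtain ⟨l, -, hl⟩ := Finset.exists_ne_zero_of_sum_ne_zero (h.trans_ne one_ne_zero)
  have hl0 : 0 < p l ^ 2 := lt_of_le_of_ne (sq_nonneg _) (Ne.symm hl)
  rw [← Finset.add_sum_erase _ _ (Finset.mem_univ l)] at h
  have hnn : 0 ≤ ∑ i ∈ Finset.univ.erase l, p i ^ 2 := Finset.sum_nonneg fun _ _ => sq_nonneg _
  refine ⟨l, mul_self_eq_one_iff.1 (by rw [← sq]; omega), fun i hi => ?_, hq⟩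
  have := (Finset.sum_eq_zero_iff_of_nonneg fun _ _ => sq_nonneg _).1
    (show ∑ i ∈ Finset.univ.erase l, p i ^ 2 = 0 by omega) i (by simp [hi])
  exact pow_eq_zero_iff (two_ne_zero) |>.1 this

variable {G : Submonoid (Matrix ι ι ℂ)}

/-- A unit vector over `ℤ[1/√2]` can be moved to a basis vector, fixing the basis vectors whose
coordinates vanish. -/
theorem exists_mulVec_eq_single
    (hswap : ∀ a b, (Equiv.swap a b).permMatrix ℂ ∈ G)
    (hhad : ∀ a b, a ≠ b → hadamardAt a b ∈ G) (hsign : ∀ a, signAt a ∈ G)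
    {T : Finset ι} {j : ι} (hj : j ∉ T) (k : ℕ) :
    ∀ (m : ℕ) (p q : ι → ℤ) (v : ι → ℂ), (Finset.univ.filter fun i => Odd (p i)).card ≤ m →
      (∀ i, v i * ω₂ ^ k = p i + q i * ω₂) → star v ⬝ᵥ v = 1 → (∀ i ∈ T, v i = 0) →
      ∃ M ∈ G, M *ᵥ v = Pi.single j 1 ∧
        ∀ i ∈ T, M *ᵥ (Pi.single i 1) = (Pi.single i 1 : ι → ℂ) := by
  -- Lexicographic descent: the denominator exponent k, then a bound m on the number of odd p i.
  induction k with
  | zero =>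
    intro m p q v _ hv h1 hT
    have hs := (sum_sq_of_unit hv h1).1
    obtain ⟨l, hl, hp, hq⟩ := unit_of_sum_eq_one (by simpa using hs)
    simp only [pow_zero, mul_one, hq, Int.cast_zero, zero_mul, add_zero] at hv
    have hlT : l ∉ T := fun h => by
      have := hT l h
      rw [hv] at this
      rcases hl with hl | hl <;> simp [hl] at this
    have hvl : v = Pi.single l ((p l : ℤ) : ℂ) := by
      ext i
      by_cases hi : i = l
      · subst hi; simp [hv]
      · simp [hv, hi, hp i hi]
    have hperm : ∀ c : ℂ, (Equiv.swap j l).permMatrix ℂ *ᵥ (Pi.single l c)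
        = (Pi.single j c : ι → ℂ) := by
      intro c
      rw [permMatrix_mulVec]
      ext x
      simp only [Function.comp, Pi.single_apply, Equiv.swap_apply_eq_iff, Equiv.swap_apply_right]
    have hpermT : ∀ i ∈ T, (Equiv.swap j l).permMatrix ℂ *ᵥ (Pi.single i 1)
        = (Pi.single i 1 : ι → ℂ) := by
      intro i hi
      rw [permMatrix_mulVec]
      ext x
      simp only [Function.comp, Pi.single_apply, Equiv.swap_apply_eq_iff]
      rw [Equiv.swap_apply_of_ne_of_ne (show i ≠ j from fun h => hj (h ▸ hi))
        (show i ≠ l from fun h => hlT (h ▸ hi))]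
    rcases hl with hl | hl
    · refine ⟨_, hswap j l, ?_, hpermT⟩
      rw [hvl, hperm, hl, Int.cast_one]
    · refine ⟨_, mul_mem (hswap j l) (hsign l), ?_, fun i hi => ?_⟩
      · rw [← mulVec_mulVec, ← hperm]
        congr 1
        ext x
        rw [signAt_mulVec, hvl, hl]
        by_cases hx : x = l
        · subst hx; simp
        · simp [hx]
      · rw [← mulVec_mulVec]
        conv_rhs => rw [← hpermT i hi]
        congr 1
        ext x
        rw [signAt_mulVec]
        split_ifs with hx
        · have : x ≠ i := fun h => hlT (hx ▸ h ▸ hi)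
          simp [this]
        · rfl
  | succ k ihk =>
    intro m
    induction m with
    | zero =>
      intro p q v hm hv h1 hT
      have hev : ∀ i, ∃ r, p i = 2 * r := by
        intro i
        have : i ∉ Finset.univ.filter fun i => Odd (p i) := by
          rw [Finset.card_eq_zero.1 (Nat.le_zero.1 hm)]; simp
        exact (Int.not_odd_iff_even.1 (by simpa using this)).exists_two_nsmul _ |>.imp
          fun r hr => by simpa using hr
      choose r hr using hev
      -- Here p i + q i √2 = √2 (q i + r i √2), so k drops by one and (q, r) replaces (p, q).
      refine ihk _ q r v le_rfl (fun i => ?_) h1 hT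
      have := hv i
      rw [hr, pow_succ] at this
      refine mul_right_cancel₀ sqrtTwo_ne_zero ?_
      push_cast at this
      linear_combination this - (r i : ℂ) * sqrtTwo_mul_self
    | succ m ihm =>
      intro p q v hm hv h1 hT
      by_cases hodd : ∃ c, Odd (p c)
      swap
      · refine ihm p q v ?_ hv h1 hT
        push Not at hodd
        simp [Finset.filter_eq_empty_iff.2 fun i _ => hodd i]
      obtain ⟨c, hc⟩ := hodd
      obtain ⟨hs, hpq⟩ := sum_sq_of_unit hv h1
      obtain ⟨a, b, hab, ha, hb, hqab⟩ := exists_pair_of_odd hs hpq hc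
      -- A vanishing coordinate has p = 0, which is even; hence a and b avoid T and the Hadamard
      -- fixes the basis vectors indexed by T.
      have hnT : ∀ i, Odd (p i) → i ∉ T := by
        intro i hi hiT
        have := hv i
        rw [hT i hiT, zero_mul] at this
        have := (int_add_mul_sqrtTwo_eq (a := p i) (b := q i) (c := 0)
          (by simpa using this.symm)).1
        rw [this] at hi
        exact absurd hi (by decide)
      obtain ⟨s, hs'⟩ : Even (p a + p b) := ha.add_odd hb
      obtain ⟨d, hd⟩ : Even (p a - p b) := ha.sub_odd hb
      have hadd : Even (q a + q b) := by
        rw [Int.even_add, ← Int.not_odd_iff_even, ← Int.not_odd_iff_even, hqab]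
      have hsub : Even (q a - q b) := by
        rw [Int.even_sub, ← Int.not_odd_iff_even, ← Int.not_odd_iff_even, hqab]
      have hfix : ∀ i ∈ T, hadamardAt a b *ᵥ (Pi.single i 1) = (Pi.single i 1 : ι → ℂ) := by
        intro i hi
        have h1 : a ≠ i := fun h => hnT a ha (h ▸ hi)
        have h2 : b ≠ i := fun h => hnT b hb (h ▸ hi)
        ext x
        rw [hadamardAt_mulVec hab]
        split_ifs with hx hx'
        · subst hx; simp [h1, h2]
        · subst hx'; simp [h1, h2]
        · rfl
      suffices h : ∃ M ∈ G, M *ᵥ (hadamardAt a b *ᵥ v) = Pi.single j 1 ∧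
          ∀ i ∈ T, M *ᵥ (Pi.single i 1) = (Pi.single i 1 : ι → ℂ) by
        obtain ⟨M, hM, hMv, hMT⟩ := h
        refine ⟨M * hadamardAt a b, mul_mem hM (hhad a b hab), ?_, fun i hi => ?_⟩
        · rw [← mulVec_mulVec, hMv]
        · rw [← mulVec_mulVec, hfix i hi, hMT i hi]
      -- Dividing (p a ± p b) + (q a ± q b)√2 by √2 gives (q a ± q b) + ((p a ± p b)/2)√2. The new
      -- p's are even because q a and q b have the same parity, so the set of odd p's loses a and b.
      refine ihm (fun i => if i = a then q a + q b else if i = b then q a - q b else p i)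
        (fun i => if i = a then s else if i = b then d else q i) _ ?_ ?_ ?_ ?_
      · refine Nat.le_of_lt_succ (lt_of_lt_of_le (Finset.card_lt_card ?_) hm)
        refine Finset.ssubset_iff_of_subset (fun i => ?_) |>.2 ⟨a, by simpa using ha, ?_⟩
        · simp only [Finset.mem_filter, Finset.mem_univ, true_and]
          split_ifs with h1 h2
          · exact fun h => absurd hadd (Int.not_even_iff_odd.2 h)
          · exact fun h => absurd hsub (Int.not_even_iff_odd.2 h)
          · exact id
        · simpa using hadd
      · intro i
        have h2 := sqrtTwo_mul_self
        have h0 := sqrtTwo_ne_zero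
        have hva := hv a
        have hvb := hv b
        have hs2 : (p a : ℂ) + p b = s + s := by exact_mod_cast hs'
        have hd2 : (p a : ℂ) - p b = d + d := by exact_mod_cast hd
        rw [hadamardAt_mulVec hab]
        split_ifs with h3 h4
        · rw [div_mul_eq_mul_div, div_eq_iff h0]
          push_cast
          linear_combination hva + hvb + hs2 - (s : ℂ) * h2
        · rw [div_mul_eq_mul_div, div_eq_iff h0]
          push_cast
          linear_combination hva - hvb + hd2 - (d : ℂ) * h2
        · exact hv i
      · rw [dotProduct_star_mulVec (hadamardAt_mem hab).1, h1]
      · intro i hi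
        rw [hadamardAt_mulVec hab, if_neg (show i ≠ a from fun h => hnT a ha (h ▸ hi)),
          if_neg (show i ≠ b from fun h => hnT b hb (h ▸ hi)), hT i hi]

/-- T indexes the columns already reduced and m counts the others. By unitarity the next column is
orthogonal to the basis vectors of T, so it vanishes on T and can be reduced without disturbing
them. -/
theorem exists_mul_eq_one (hG : G ≤ unitaryRing ι)
    (hswap : ∀ a b, (Equiv.swap a b).permMatrix ℂ ∈ G)
    (hhad : ∀ a b, a ≠ b → hadamardAt a b ∈ G) (hsign : ∀ a, signAt a ∈ G) (m : ℕ) :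
    ∀ (T : Finset ι) (V : Matrix ι ι ℂ), Tᶜ.card = m → V ∈ unitaryRing ι →
      (∀ i ∈ T, V *ᵥ (Pi.single i 1) = (Pi.single i 1 : ι → ℂ)) → ∃ M ∈ G, M * V = 1 := by
  induction m with
  | zero =>
    intro T V hT hV hfix
    refine ⟨1, one_mem _, ?_⟩
    rw [Finset.card_eq_zero, Finset.compl_eq_empty_iff] at hT
    subst hT
    refine ext_of_mulVec_single fun i => ?_
    rw [one_mul, one_mulVec, hfix i (Finset.mem_univ i)]
  | succ m ih =>
    intro T V hT hV hfix
    obtain ⟨j, hj⟩ := Finset.card_pos.1 (hT.symm ▸ Nat.succ_pos m : 0 < Tᶜ.card)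
    rw [Finset.mem_compl] at hj
    obtain ⟨k, p, q, hpq⟩ := exists_common_sqrtTwo_pow_mul
      (v := V *ᵥ (Pi.single j 1)) fun i => by
        rw [mulVec_single_one]
        exact hV.2 _ _
    obtain ⟨M, hM, hMj, hMT⟩ := exists_mulVec_eq_single hswap hhad hsign hj k _ p q _ le_rfl
      hpq (by rw [dotProduct_star_mulVec hV.1]; simp) (fun i hi => by
        have h := dotProduct_star_mulVec hV.1 (Pi.single i 1) (Pi.single j 1)
        rw [hfix i hi] at h
        have hij : i ≠ j := fun h => hj (h ▸ hi)
        simpa [Pi.star_single, hij] using h)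
    obtain ⟨N, hN, hNM⟩ := ih (insert j T) (M * V)
      (by rw [Finset.compl_insert, Finset.card_erase_of_mem (by simpa using hj), hT]; rfl)
      (mul_mem (hG hM) hV) (fun i hi => by
        rw [← mulVec_mulVec]
        rcases Finset.mem_insert.1 hi with rfl | hi
        · exact hMj
        · rw [hfix i hi, hMT i hi])
    exact ⟨N * M, mul_mem hN hM, by rw [mul_assoc, hNM]⟩

/-- A submonoid containing the one- and two-level matrices contains all unitary matrices over
`ℤ[1/√2]`. -/
theorem unitaryRing_le (hswap : ∀ a b, (Equiv.swap a b).permMatrix ℂ ∈ G)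
    (hhad : ∀ a b, a ≠ b → hadamardAt a b ∈ G) (hsign : ∀ a, signAt a ∈ G) :
    unitaryRing ι ≤ G := by
  intro V hV
  -- Reducing `star V` rather than V makes the reducing product equal to V itself, so G need not be
  -- closed under inverses. Intersecting with the unitary matrices keeps every intermediate matrix
  -- unitary over the ring.
  obtain ⟨M, hM, hMV⟩ := exists_mul_eq_one (G := G ⊓ unitaryRing ι) inf_le_right
    (fun a b => ⟨hswap a b, permMatrix_mem _⟩) (fun a b h => ⟨hhad a b h, hadamardAt_mem h⟩)
    (fun a => ⟨hsign a, signAt_mem a⟩) _ ∅ (star V) rfl (star_mem_unitaryRing hV) (by simp)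
  have : M = V := by
    rw [← mul_one M, ← mem_unitaryGroup_iff'.1 hV.1, ← mul_assoc, hMV, one_mul]
  exact this ▸ hM.1

end Synthesis

/-! ### Operators of circuits are unitary over `ℤ[1/√2]` -/

/-- Only labels agreeing with x off the selected wires contribute, and `Function.extend w b x`
enumerates them. -/
theorem place_mulVec {k N : ℕ} (U : Op k) (w : Fin k ↪ Fin N) (v : Bits N → ℂ) (x : Bits N) :
    (place U w *ᵥ v) x = ∑ b, U (fun j => x (w j)) b * v (Function.extend w b x) := by
  classical
  simp only [mulVec, dotProduct, place, ite_mul, zero_mul]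
  rw [← Finset.sum_filter]
  symm
  refine Finset.sum_bij' (fun b _ => Function.extend w b x) (fun y _ j => y (w j)) ?_ ?_ ?_ ?_ ?_
  · intro b _
    simp only [Finset.mem_filter, Finset.mem_univ, true_and]
    intro i hi
    rw [Function.extend_apply' _ _ _ (by simpa using hi)]
  · intros; exact Finset.mem_univ _
  · intro b _
    ext j
    rw [w.injective.extend_apply]
  · intro y hy
    simp only [Finset.mem_filter, Finset.mem_univ, true_and] at hy
    funext i
    by_cases hi : i ∈ Set.range w
    · obtain ⟨j, rfl⟩ := hi
      rw [w.injective.extend_apply]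
    · rw [Function.extend_apply' _ _ _ (by simpa using hi), hy i hi]
  · intro b _
    simp only [w.injective.extend_apply]

theorem place_mul {k N : ℕ} (U V : Op k) (w : Fin k ↪ Fin N) :
    place U w * place V w = place (U * V) w := by
  refine matrix_ext_mulVec fun v x => ?_
  rw [← mulVec_mulVec, place_mulVec, place_mulVec]
  simp only [place_mulVec, w.injective.extend_apply, mul_apply, Finset.mul_sum, Finset.sum_mul]
  rw [Finset.sum_comm]
  refine Finset.sum_congr rfl fun b _ => Finset.sum_congr rfl fun c _ => ?_
  have : Function.extend w b (Function.extend w c x) = Function.extend w b x := by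
    funext i
    by_cases hi : i ∈ Set.range w
    · obtain ⟨j, rfl⟩ := hi
      simp only [w.injective.extend_apply]
    · simp only [Function.extend_apply' _ _ _ (show ¬∃ a, w a = i by simpa using hi)]
  rw [this, mul_assoc]

theorem place_one {k N : ℕ} (w : Fin k ↪ Fin N) : place (1 : Op k) w = 1 := by
  refine matrix_ext_mulVec fun v x => ?_
  rw [place_mulVec, one_mulVec, Finset.sum_eq_single fun j => x (w j)]
  · have : Function.extend w (fun j => x (w j)) x = x := by
      funext i
      by_cases hi : i ∈ Set.range w
      · obtain ⟨j, rfl⟩ := hi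
        rw [w.injective.extend_apply]
      · rw [Function.extend_apply' _ _ _ (by simpa using hi)]
    rw [this, one_apply_eq, one_mul]
  · intro b _ hb
    rw [one_apply_ne' hb, zero_mul]
  · simp

theorem star_place {k N : ℕ} (U : Op k) (w : Fin k ↪ Fin N) : star (place U w) = place (star U) w := by
  ext x y
  simp only [star_apply, place, eq_comm (a := x _)]
  split_ifs <;> simp

theorem place_mem {k N : ℕ} {U : Op k} (hU : U ∈ unitaryRing (Bits k)) (w : Fin k ↪ Fin N) :
    place U w ∈ unitaryRing (Bits N) := by
  refine ⟨mem_unitaryGroup_iff.2 ?_, fun x y => ?_⟩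
  · rw [star_place, place_mul, mem_unitaryGroup_iff.1 hU.1, place_one]
  · simp only [place]
    split_ifs
    exacts [hU.2 _ _, zero_mem _]

theorem sum_bits_add {a b : ℕ} (f : Bits (a + b) → ℂ) :
    ∑ x, f x = ∑ y, ∑ z, f (Fin.append y z) := by
  rw [← Fintype.sum_prod_type', ← (Fin.appendEquiv a b).sum_comp]
  rfl

theorem left_append {a b : ℕ} (y : Bits a) (z : Bits b) : left (Fin.append y z) = y := by
  ext; simp [left]

theorem right_append {a b : ℕ} (y : Bits a) (z : Bits b) : right (Fin.append y z) = z := by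
  ext; simp [right]

theorem append_left_right {a b : ℕ} (x : Bits (a + b)) : Fin.append (left x) (right x) = x :=
  Fin.append_castAdd_natAdd

theorem tensorOp_mul {a b : ℕ} (A B : Op a) (C D : Op b) :
    tensorOp A C * tensorOp B D = tensorOp (A * B) (C * D) := by
  ext x y
  simp only [mul_apply, sum_bits_add, tensorOp, left_append, right_append, Finset.sum_mul_sum]
  refine Finset.sum_congr rfl fun _ _ => Finset.sum_congr rfl fun _ _ => by ring

theorem tensorOp_one {a b : ℕ} : tensorOp (1 : Op a) (1 : Op b) = 1 := by
  ext x y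
  have : x = y ↔ left x = left y ∧ right x = right y :=
    ⟨fun h => h ▸ ⟨rfl, rfl⟩, fun h => by
      rw [← append_left_right x, ← append_left_right y, h.1, h.2]⟩
  simp only [tensorOp, one_apply, this]
  split_ifs <;> simp_all

theorem tensorOp_mem {a b : ℕ} {A : Op a} {B : Op b} (hA : A ∈ unitaryRing (Bits a))
    (hB : B ∈ unitaryRing (Bits b)) : tensorOp A B ∈ unitaryRing (Bits (a + b)) := by
  refine ⟨mem_unitaryGroup_iff.2 ?_, fun x y => mul_mem (hA.2 _ _) (hB.2 _ _)⟩
  have : star (tensorOp A B) = tensorOp (star A) (star B) := by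
    ext x y
    simp [star_apply, tensorOp]
  rw [this, tensorOp_mul, mem_unitaryGroup_iff.1 hA.1, mem_unitaryGroup_iff.1 hB.1, tensorOp_one]

theorem single_mem {A : Matrix (Fin 2) (Fin 2) ℂ} (hA : A ∈ unitaryRing (Fin 2)) :
    single A ∈ unitaryRing (Bits 1) := by
  refine ⟨mem_unitaryGroup_iff.2 ?_, fun x y => hA.2 _ _⟩
  ext x y
  have h := congrFun₂ (mem_unitaryGroup_iff.1 hA.1) (x 0) (y 0)
  simp only [mul_apply, star_apply, single] at h ⊢
  refine ((Equiv.funUnique (Fin 1) (Fin 2)).sum_comp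
    (fun z => A (x 0) z * star (A (y 0) z))).trans (h.trans ?_)
  simp only [one_apply, funext_iff, Fin.forall_fin_one]

theorem ctrl_mul {k : ℕ} (U V : Op k) : ctrl U * ctrl V = ctrl (U * V) := by
  ext x y
  rw [mul_apply, ← (Fin.consEquiv fun _ => Fin 2).sum_comp, Fintype.sum_prod_type]
  have htail : ∀ (c : Fin 2) (z : Bits k), Fin.tail (Fin.consEquiv (fun _ => Fin 2) (c, z)) = z :=
    fun c z => Fin.tail_cons (α := fun _ => Fin 2) c z
  simp only [Fin.sum_univ_two, ctrl, htail, Fin.consEquiv_apply, Fin.cons_zero]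
  rcases Fin.exists_fin_two.1 ⟨x 0, rfl⟩ with hx | hx <;>
    rcases Fin.exists_fin_two.1 ⟨y 0, rfl⟩ with hy | hy <;>
    simp [hx, hy, mul_apply, one_apply]

theorem ctrl_one {k : ℕ} : ctrl (1 : Op k) = 1 := by
  ext x y
  have : x = y ↔ x 0 = y 0 ∧ Fin.tail x = Fin.tail y := by
    rw [funext_iff, Fin.forall_fin_succ, funext_iff]
    rfl
  simp only [ctrl, ite_self, one_apply, this]
  split_ifs <;> simp_all

theorem ctrl_mem {k : ℕ} {U : Op k} (hU : U ∈ unitaryRing (Bits k)) :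
    ctrl U ∈ unitaryRing (Bits (k + 1)) := by
  refine ⟨mem_unitaryGroup_iff.2 ?_, fun x y => ?_⟩
  · have : star (ctrl U) = ctrl (star U) := by
      ext x y
      simp only [star_apply, ctrl]
      by_cases h1 : x 0 = y 0
      · rw [h1]
        split_ifs
        · rw [← star_apply, star_one]
        · rfl
        · exact star_zero _
      · rw [if_neg h1, if_neg (Ne.symm h1), star_zero]
    rw [this, ctrl_mul, mem_unitaryGroup_iff.1 hU.1, ctrl_one]
  · simp only [ctrl]
    split_ifs
    exacts [(one_mem (unitaryRing (Bits k))).2 _ _, hU.2 _ _, zero_mem _]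

theorem notMatrix_eq : !![0, 1; 1, 0] = (Equiv.swap (0 : Fin 2) 1).permMatrix ℂ := by
  ext i j
  fin_cases i <;> fin_cases j <;> simp [Equiv.Perm.permMatrix, PEquiv.toMatrix_apply]

theorem hadamardMatrix_eq :
    (1 / (Real.sqrt 2 : ℂ)) • !![1, 1; 1, -1] = hadamardAt (0 : Fin 2) 1 := by
  ext i j
  fin_cases i <;> fin_cases j <;> simp [hadamardAt]

theorem realGates_mem {k : ℕ} {U : Op k} (h : (⟨k, U⟩ : Σ k : ℕ, Op k) ∈ realGates) :
    U ∈ unitaryRing (Bits k) := by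
  have hX : gateX ∈ unitaryRing (Bits 1) :=
    single_mem (notMatrix_eq ▸ permMatrix_mem _)
  have hH : gateH ∈ unitaryRing (Bits 1) :=
    single_mem (hadamardMatrix_eq ▸ hadamardAt_mem (by decide))
  rcases h with h | h | h | h | h <;> cases h
  exacts [hX, ctrl_mem hX, ctrl_mem (ctrl_mem hX), hH, ctrl_mem hH]

theorem Circuit.eval_mem {N : ℕ} (C : Circuit realGates N) : C.eval ∈ unitaryRing (Bits N) := by
  induction C with
  | id n => exact one_mem _
  | gate U hU w => exact place_mem (realGates_mem hU) w
  | comp C D hC hD => exact mul_mem hD hC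
  | tensor C D hC hD => exact tensorOp_mem hC hD

theorem Representable.mem_unitaryRing {n : ℕ} {V : Op n} (h : Representable realGates V) :
    V ∈ unitaryRing (Bits n) := by
  obtain ⟨m, D, hD⟩ := h
  have hDm := D.eval_mem
  have hcol : ∀ y : Bits n, D.eval *ᵥ (tensorVec (Pi.single y 1) (ketZero m))
      = tensorVec (fun x => V x y) (ketZero m) := by
    intro y
    -- Basis vectors have norm one, so the hypothesis on states already determines every column.
    have h := hD (Pi.single y 1) (by
      rw [IsState, Finset.sum_eq_single y] <;> simp +contextual)
    rwa [mulVec_single_one] at h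
  have hdot : ∀ v w : Bits n → ℂ, star (tensorVec v (ketZero m)) ⬝ᵥ tensorVec w (ketZero m)
      = star v ⬝ᵥ w := by
    intro v w
    simp only [dotProduct, sum_bits_add, Pi.star_apply, tensorVec, left_append, right_append]
    refine Finset.sum_congr rfl fun x _ => ?_
    rw [Finset.sum_eq_single 0] <;> simp +contextual [ketZero]
  refine ⟨mem_unitaryGroup_iff'.2 ?_, fun x y => ?_⟩
  · ext y z
    have h := dotProduct_star_mulVec hDm.1 (tensorVec (Pi.single y 1) (ketZero m))
      (tensorVec (Pi.single z 1) (ketZero m))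
    rw [hcol, hcol, hdot, hdot] at h
    rw [mul_apply]
    simp only [star_apply]
    refine h.trans ?_
    simp [Pi.star_single, Pi.single_apply, one_apply, eq_comm]
  · have h := congrFun (hcol y) (Fin.append x 0)
    have hv : V x y = tensorVec (fun x => V x y) (ketZero m) (Fin.append x 0) := by
      simp [tensorVec, left_append, right_append, ketZero]
    rw [hv, ← h]
    refine mulVec_mem_ring hDm (fun i => ?_) _
    simp only [tensorVec, ketZero, Pi.single_apply]
    split_ifs <;> simp

/-! ### Multiply controlled gates -/

/-- The one-qubit gate `A` on the wire `t`, controlled by the wires in `S`. -/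
def controlled {N : ℕ} (S : Finset (Fin N)) (t : Fin N) (A : Matrix (Fin 2) (Fin 2) ℂ) : Op N :=
  fun x y => if ∀ i, i ≠ t → x i = y i then
    (if ∀ i ∈ S, x i = 1 then A else 1) (x t) (y t) else 0

theorem controlled_mulVec {N : ℕ} (S : Finset (Fin N)) (t : Fin N) (A : Matrix (Fin 2) (Fin 2) ℂ)
    (v : Bits N → ℂ) (x : Bits N) :
    (controlled S t A *ᵥ v) x = if ∀ i ∈ S, x i = 1 then
      ∑ b, A (x t) b * v (Function.update x t b) else v x := by
  have key : ∀ B : Matrix (Fin 2) (Fin 2) ℂ,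
      ∑ y, (if ∀ i, i ≠ t → x i = y i then B (x t) (y t) else 0) * v y
        = ∑ b, B (x t) b * v (Function.update x t b) := by
    intro B
    simp only [ite_mul, zero_mul]
    rw [← Finset.sum_filter]
    symm
    refine Finset.sum_bij' (fun b _ => Function.update x t b) (fun y _ => y t) ?_ ?_ ?_ ?_ ?_
    · intro b _
      simp only [Finset.mem_filter, Finset.mem_univ, true_and]
      intro i hi
      rw [Function.update_of_ne hi]
    · intros; exact Finset.mem_univ _
    · simp
    · intro y hy
      simp only [Finset.mem_filter, Finset.mem_univ, true_and] at hy
      funext i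
      by_cases hi : i = t
      · subst hi; simp
      · rw [Function.update_of_ne hi, hy i hi]
    · intro b _
      simp
  simp only [mulVec, dotProduct, controlled]
  rw [key]
  split_ifs
  · rfl
  · simp [one_apply]

/-- The circuit operators on `N` wires. -/
def circuitOps (N : ℕ) : Submonoid (Op N) where
  carrier := {A | ∃ C : Circuit realGates N, C.eval = A}
  one_mem' := ⟨.id N, rfl⟩
  mul_mem' := by
    rintro _ _ ⟨C, rfl⟩ ⟨D, rfl⟩
    exact ⟨.comp D C, rfl⟩

theorem place_single {N : ℕ} (A : Matrix (Fin 2) (Fin 2) ℂ) (w : Fin 1 ↪ Fin N) :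
    place (single A) w = controlled ∅ (w 0) A := by
  ext x y
  have : (∀ i, i ∉ Set.range w → x i = y i) ↔ ∀ i, i ≠ w 0 → x i = y i := by
    simp [Set.mem_range, Fin.exists_fin_one, eq_comm]
  simp only [place, this, controlled, single, Finset.notMem_empty, false_imp_iff, implies_true,
    if_true]

/-- Peels off one control, row by row. With the same recursion for `controlled` in
`controlled_insert`, this identifies the placed CX, CCX and CH gates as controlled operators. -/
theorem place_ctrl {k N : ℕ} (U : Op k) (w : Fin (k + 1) ↪ Fin N) (x y : Bits N) :
    place (ctrl U) w x y =
      (if x (w 0) = 1 then place U ((Fin.succEmb k).trans w) else 1) x y := by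
  have hr : ∀ i, i ∈ Set.range w ↔ i = w 0 ∨ i ∈ Set.range ((Fin.succEmb k).trans w) := by
    intro i
    simp only [Set.mem_range, Fin.exists_fin_succ, eq_comm (a := i)]
    rfl
  have h0 : w 0 ∉ Set.range ((Fin.succEmb k).trans w) := by
    rintro ⟨j, hj⟩
    exact Fin.succ_ne_zero j (w.injective hj)
  have hC : (∀ i, i ∉ Set.range ((Fin.succEmb k).trans w) → x i = y i) ↔
      (∀ i, i ∉ Set.range w → x i = y i) ∧ x (w 0) = y (w 0) := by
    constructor
    · exact fun h => ⟨fun i hi => h i fun h' => hi ((hr i).2 (Or.inr h')), h _ h0⟩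
    · rintro ⟨h, h'⟩ i hi
      by_cases hi0 : i = w 0
      · exact hi0 ▸ h'
      · exact h i fun hw => ((hr i).1 hw).elim hi0 hi
  have h : place (ctrl U) w x y =
      place (if x (w 0) = 1 then U else 1) ((Fin.succEmb k).trans w) x y := by
    have h01 : (if x (w 0) = 0 then (1 : Op k) else U) = if x (w 0) = 1 then U else 1 := by
      rcases Fin.exists_fin_two.1 ⟨x (w 0), rfl⟩ with h | h <;> simp [h]
    simp only [place, ctrl, hC, ite_and, h01]
    rfl
  rw [h]
  split_ifs
  · rfl
  · rw [place_one]

theorem controlled_insert {N : ℕ} {S : Finset (Fin N)} {c t : Fin N}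
    (A : Matrix (Fin 2) (Fin 2) ℂ) (x y : Bits N) :
    controlled (insert c S) t A x y = (if x c = 1 then controlled S t A else 1) x y := by
  have h1 : (1 : Op N) x y =
      if ∀ i, i ≠ t → x i = y i then (1 : Matrix (Fin 2) (Fin 2) ℂ) (x t) (y t) else 0 := by
    simp only [one_apply]
    rw [← ite_and]
    congr 1
    rw [funext_iff, eq_iff_iff]
    exact ⟨fun h => ⟨fun i _ => h i, h t⟩, fun h i => by
      by_cases hi : i = t
      · exact hi ▸ h.2
      · exact h.1 i hi⟩
  by_cases h : x c = 1
  · simp [controlled, h]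
  · simp [controlled, h, h1]

theorem gate_mem {k N : ℕ} {U : Op k} (hU : (⟨k, U⟩ : Σ k : ℕ, Op k) ∈ realGates)
    (w : Fin k ↪ Fin N) : place U w ∈ circuitOps N := ⟨.gate U hU w, rfl⟩

def notMatrix : Matrix (Fin 2) (Fin 2) ℂ := !![0, 1; 1, 0]

def hadamardMatrix : Matrix (Fin 2) (Fin 2) ℂ := (1 / (Real.sqrt 2 : ℂ)) • !![1, 1; 1, -1]

theorem place_ctrl_single {N : ℕ} (A : Matrix (Fin 2) (Fin 2) ℂ) (w : Fin 2 ↪ Fin N) :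
    place (ctrl (single A)) w = controlled {w 0} (w 1) A := by
  ext x y
  rw [place_ctrl, place_single, ← insert_empty_eq, controlled_insert]
  rfl

theorem controlled_not_mem₀ {N : ℕ} (t : Fin N) : controlled ∅ t notMatrix ∈ circuitOps N := by
  have h := gate_mem (N := N) (U := gateX) (by simp [realGates]) ⟨fun _ => t, fun i j _ =>
    Subsingleton.elim i j⟩
  rwa [gateX, place_single] at h

theorem controlled_hadamard_mem₀ {N : ℕ} (t : Fin N) :
    controlled ∅ t hadamardMatrix ∈ circuitOps N := by
  have h := gate_mem (N := N) (U := gateH) (by simp [realGates]) ⟨fun _ => t, fun i j _ =>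
    Subsingleton.elim i j⟩
  rwa [gateH, place_single] at h

theorem controlled_not_mem₁ {N : ℕ} {c t : Fin N} (h : c ≠ t) :
    controlled {c} t notMatrix ∈ circuitOps N := by
  have h := gate_mem (N := N) (U := gateCX) (by simp [realGates]) ⟨![c, t], by
    intro i j; fin_cases i <;> fin_cases j <;> simp [h, h.symm]⟩
  rwa [gateCX, gateX, place_ctrl_single] at h

theorem controlled_hadamard_mem₁ {N : ℕ} {c t : Fin N} (h : c ≠ t) :
    controlled {c} t hadamardMatrix ∈ circuitOps N := by
  have h := gate_mem (N := N) (U := gateCH) (by simp [realGates]) ⟨![c, t], by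
    intro i j; fin_cases i <;> fin_cases j <;> simp [h, h.symm]⟩
  rwa [gateCH, gateH, place_ctrl_single] at h

theorem controlled_not_mem₂ {N : ℕ} {c d t : Fin N} (hcd : c ≠ d) (hc : c ≠ t) (hd : d ≠ t) :
    controlled {c, d} t notMatrix ∈ circuitOps N := by
  have h := gate_mem (N := N) (U := gateCCX) (by simp [realGates]) ⟨![c, d, t], by
    intro i j; fin_cases i <;> fin_cases j <;> simp [hcd, hcd.symm, hc, hc.symm, hd, hd.symm]⟩
  rw [gateCCX, gateX] at h
  convert h using 1
  ext x y
  rw [place_ctrl, place_ctrl_single, controlled_insert]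
  rfl

/-- The classical action of the multiply controlled NOT gate. -/
def flip {N : ℕ} (S : Finset (Fin N)) (t : Fin N) (x : Bits N) : Bits N :=
  fun i => if i = t ∧ ∀ j ∈ S, x j = 1 then x i + 1 else x i

theorem controlled_not_mulVec {N : ℕ} (S : Finset (Fin N)) (t : Fin N) (v : Bits N → ℂ)
    (x : Bits N) : (controlled S t notMatrix *ᵥ v) x = v (flip S t x) := by
  rw [controlled_mulVec]
  split_ifs with h
  · have : flip S t x = Function.update x t (x t + 1) := by
      funext i
      by_cases hi : i = t
      · subst hi; simp [flip]; exact h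
      · simp [flip, hi]
    rw [this, Fin.sum_univ_two]
    rcases Fin.exists_fin_two.1 ⟨x t, rfl⟩ with hx | hx <;> simp [hx, notMatrix]
  · have : flip S t x = x := by
      funext i
      simp [flip, h]
    rw [this]

theorem fin_two_add_one_add_one (b : Fin 2) : b + 1 + 1 = b := by
  fin_cases b <;> rfl

theorem flip_apply_of_ne {N : ℕ} (S : Finset (Fin N)) {t i : Fin N} (h : i ≠ t) (x : Bits N) :
    flip S t x i = x i := by
  simp [flip, h]

theorem flip_apply_self {N : ℕ} (S : Finset (Fin N)) (t : Fin N) (x : Bits N) :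
    flip S t x t = if ∀ j ∈ S, x j = 1 then x t + 1 else x t := by
  simp [flip]

theorem forall_flip_eq_one {N : ℕ} {S T : Finset (Fin N)} {t : Fin N} (h : t ∉ T) (x : Bits N) :
    (∀ j ∈ T, flip S t x j = 1) ↔ ∀ j ∈ T, x j = 1 :=
  forall₂_congr fun j hj => by rw [flip_apply_of_ne _ (show j ≠ t from fun h' => h (h' ▸ hj))]

/-- Let s and τ be the conjunctions over S and T, as bits. The target t receives dτ and then (d +
s)τ, in total sτ modulo 2, while d receives s twice and is restored. The initial value of d is
irrelevant: d is only borrowed. -/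
theorem flip_commutator {N : ℕ} {S T : Finset (Fin N)} {t d : Fin N} (htS : t ∉ S) (htT : t ∉ T)
    (hdS : d ∉ S) (hdT : d ∉ T) (hdt : d ≠ t) (x : Bits N) :
    flip S d (flip (insert d T) t (flip S d (flip (insert d T) t x))) = flip (S ∪ T) t x := by
  funext i
  by_cases hi : i = t
  · subst hi
    rw [flip_apply_of_ne _ hdt.symm]
    simp only [flip_apply_self, Finset.forall_mem_insert, forall_flip_eq_one htT,
      forall_flip_eq_one htS, forall_flip_eq_one hdT, flip_apply_of_ne _ hdt,
      flip_apply_of_ne _ hdt.symm, Finset.mem_union, or_imp, forall_and]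
    rcases Classical.propComplete (∀ j ∈ S, x j = 1) with hS | hS <;>
      rcases Classical.propComplete (∀ j ∈ T, x j = 1) with hT | hT <;>
      rcases Fin.exists_fin_two.1 ⟨x d, rfl⟩ with hd | hd <;>
      simp only [hS, hT, hd] <;> simp [fin_two_add_one_add_one]
  · by_cases hid : i = d
    · subst hid
      simp only [flip_apply_self, forall_flip_eq_one htS, forall_flip_eq_one hdS,
        flip_apply_of_ne _ hdt]
      split_ifs
      · exact fin_two_add_one_add_one _
      · rfl
    · simp only [flip_apply_of_ne _ hi, flip_apply_of_ne _ hid]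

/-- A multiply controlled NOT gate can be built with one borrowed wire. -/
theorem controlled_not_mem {N : ℕ} (m : ℕ) :
    ∀ (S : Finset (Fin N)) (t d : Fin N), S.card ≤ m → t ∉ S → d ∉ S → d ≠ t →
      controlled S t notMatrix ∈ circuitOps N := by
  induction m with
  | zero =>
    intro S t d hS ht hd hdt
    rw [Finset.card_eq_zero.1 (Nat.le_zero.1 hS)]
    exact controlled_not_mem₀ t
  | succ m ih =>
    intro S t d hS ht hd hdt
    -- Up to two controls the operator is X, CX or CCX. From three on, the commutator uses gates
    -- with 2 and |S| − 1 controls, both fewer.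
    rcases Nat.lt_or_ge S.card 3 with h3 | h3
    · interval_cases h : S.card
      · rw [Finset.card_eq_zero.1 h]
        exact controlled_not_mem₀ t
      · obtain ⟨c, rfl⟩ := Finset.card_eq_one.1 h
        exact controlled_not_mem₁ (by simpa [eq_comm] using ht)
      · obtain ⟨c, e, hce, rfl⟩ := Finset.card_eq_two.1 h
        simp only [Finset.mem_insert, Finset.mem_singleton, not_or] at ht
        exact controlled_not_mem₂ hce (Ne.symm ht.1) (Ne.symm ht.2)
    · obtain ⟨P, hPS, hP⟩ := Finset.exists_subset_card_eq (show 2 ≤ S.card by omega)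
      obtain ⟨a, ha⟩ : P.Nonempty := Finset.card_pos.1 (by omega)
      have hcard : (S \ P).card = S.card - 2 := by rw [Finset.card_sdiff_of_subset hPS, hP]
      -- Each factor needs a borrowed wire of its own: t serves for the gate targeting d, and a ∈ P
      -- for the gate targeting t.
      have hdP : d ∉ S \ P := fun h => hd (Finset.sdiff_subset h)
      have htP : t ∉ S \ P := fun h => ht (Finset.sdiff_subset h)
      have h1 := ih P d t (by omega) (fun h => hd (hPS h)) (fun h => ht (hPS h)) hdt.symm
      have h2 := ih (insert d (S \ P)) t a (by rw [Finset.card_insert_of_notMem hdP]; omega)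
        (by simp [htP, hdt.symm])
        (by simp [ha, show a ≠ d from fun h => hd (h ▸ hPS ha)])
        (fun h => ht (h ▸ hPS ha))
      have h3 := mul_mem (mul_mem h2 h1) (mul_mem h2 h1)
      convert h3 using 1
      refine matrix_ext_mulVec fun v x => ?_
      simp only [← mulVec_mulVec, controlled_not_mulVec]
      rw [flip_commutator (fun h => ht (hPS h)) htP (fun h => hd (hPS h)) hdP hdt,
        Finset.union_sdiff_of_subset hPS]

/-! ### Operators represented with one clean ancilla -/

/-- Operators represented by a circuit with one clean ancilla. -/
def ancillaOps (n : ℕ) : Submonoid (Op n) where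
  carrier := {V | ∃ A ∈ circuitOps (n + 1), ∀ ψ : Bits n → ℂ,
    A *ᵥ tensorVec ψ (ketZero 1) = tensorVec (V *ᵥ ψ) (ketZero 1)}
  one_mem' := ⟨1, one_mem _, fun ψ => by rw [one_mulVec, one_mulVec]⟩
  mul_mem' := by
    rintro V W ⟨A, hA, hV⟩ ⟨B, hB, hW⟩
    exact ⟨A * B, mul_mem hA hB, fun ψ => by rw [← mulVec_mulVec, hW, hV, mulVec_mulVec]⟩

theorem left_update {a b : ℕ} (x : Bits (a + b)) (t : Fin a) (c : Fin 2) :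
    left (Function.update x (Fin.castAdd b t) c) = Function.update (left x) t c := by
  funext i
  by_cases hi : i = t
  · subst hi; simp [left]
  · have : Fin.castAdd b i ≠ Fin.castAdd b t := fun h => hi (Fin.castAdd_injective _ _ h)
    simp [left, hi, this]

theorem castAdd_ne_natAdd {a b : ℕ} (i : Fin a) (j : Fin b) : Fin.castAdd b i ≠ Fin.natAdd a j := by
  intro h
  have := congrArg Fin.val h
  simp only [Fin.val_castAdd, Fin.val_natAdd] at this
  omega

theorem right_update {a b : ℕ} (x : Bits (a + b)) (t : Fin a) (c : Fin 2) :
    right (Function.update x (Fin.castAdd b t) c) = right x := by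
  funext i
  exact Function.update_of_ne (castAdd_ne_natAdd t i).symm _ _

theorem controlled_mulVec_tensorVec {a b : ℕ} (S : Finset (Fin a)) (t : Fin a)
    (A : Matrix (Fin 2) (Fin 2) ℂ) (ψ : Bits a → ℂ) (φ : Bits b → ℂ) :
    controlled (S.map (Fin.castAddEmb b)) (Fin.castAdd b t) A *ᵥ tensorVec ψ φ
      = tensorVec (controlled S t A *ᵥ ψ) φ := by
  funext x
  have hc : (∀ i ∈ S.map (Fin.castAddEmb b), x i = 1) ↔ ∀ i ∈ S, left x i = 1 :=
    Finset.forall_mem_map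
  have ht : x (Fin.castAdd b t) = left x t := rfl
  simp only [controlled_mulVec, tensorVec, left_update, right_update, hc, ht]
  split_ifs
  · rw [Finset.sum_mul]
    exact Finset.sum_congr rfl fun _ _ => (mul_assoc _ _ _).symm
  · rfl

theorem castAdd_notMem_map {a b : ℕ} {S : Finset (Fin a)} {t : Fin a} (h : t ∉ S) :
    Fin.castAdd b t ∉ S.map (Fin.castAddEmb b) := by
  intro h'
  obtain ⟨i, hi, hit⟩ := Finset.mem_map.1 h'
  exact h (Fin.castAdd_injective _ _ hit ▸ hi)

theorem natAdd_notMem_map {a b : ℕ} (S : Finset (Fin a)) (j : Fin b) :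
    Fin.natAdd a j ∉ S.map (Fin.castAddEmb b) := by
  intro h'
  obtain ⟨i, hi, hit⟩ := Finset.mem_map.1 h'
  exact castAdd_ne_natAdd i j hit

/-- The ancilla is the borrowed wire; its state plays no role here. -/
theorem controlled_not_mem_ancillaOps {n : ℕ} {S : Finset (Fin n)} {t : Fin n} (h : t ∉ S) :
    controlled S t notMatrix ∈ ancillaOps n :=
  ⟨_, controlled_not_mem _ (S.map (Fin.castAddEmb 1)) (Fin.castAdd 1 t) (Fin.natAdd n 0) le_rfl
    (castAdd_notMem_map h) (natAdd_notMem_map S 0) (castAdd_ne_natAdd t 0).symm,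
    fun ψ => controlled_mulVec_tensorVec S t _ ψ _⟩

theorem tensorVec_ketZero_one {n : ℕ} (ψ : Bits n → ℂ) (x : Bits (n + 1)) :
    tensorVec ψ (ketZero 1) x = if x (Fin.natAdd n 0) = 0 then ψ (left x) else 0 := by
  have : right x = 0 ↔ x (Fin.natAdd n 0) = 0 := by
    rw [funext_iff, Fin.forall_fin_one]
    rfl
  simp only [tensorVec, ketZero, Pi.single_apply, this, mul_ite, mul_one, mul_zero]

/-- Uncomputation: changing t leaves the conjunction over S unchanged, so the second flip undoes the
first on d. -/
theorem flip_update_flip {N : ℕ} {S : Finset (Fin N)} {t d : Fin N} (ht : t ∉ S) (hd : d ∉ S)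
    (hdt : d ≠ t) (b : Fin 2) (x : Bits N) :
    flip S d (Function.update (flip S d x) t b) = Function.update x t b := by
  have hS : (∀ j ∈ S, Function.update (flip S d x) t b j = 1) ↔ ∀ j ∈ S, x j = 1 :=
    (forall₂_congr fun j hj => by
      rw [Function.update_of_ne (show j ≠ t from fun h' => ht (h' ▸ hj))]).trans
      (forall_flip_eq_one hd x)
  funext i
  by_cases hi : i = d
  · subst hi
    rw [flip_apply_self, Function.update_of_ne hdt, Function.update_of_ne hdt, flip_apply_self]
    simp only [hS]
    split_ifs
    · exact fin_two_add_one_add_one _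
    · rfl
  · rw [flip_apply_of_ne _ hi]
    by_cases hit : i = t
    · subst hit; simp
    · rw [Function.update_of_ne hit, Function.update_of_ne hit, flip_apply_of_ne _ hi]

theorem flip_flip {N : ℕ} {S : Finset (Fin N)} {t : Fin N} (ht : t ∉ S) (x : Bits N) :
    flip S t (flip S t x) = x := by
  funext i
  by_cases hi : i = t
  · subst hi
    simp only [flip_apply_self, forall_flip_eq_one ht]
    split_ifs
    · exact fin_two_add_one_add_one _
    · rfl
  · simp only [flip_apply_of_ne _ hi]

/-- Write the conjunction of the controls into the clean ancilla d, apply CH from d to the target,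
and uncompute. The target serves as borrowed wire for the multiply controlled NOT. -/
theorem controlled_hadamard_mem_ancillaOps {n : ℕ} {S : Finset (Fin n)} {t : Fin n} (h : t ∉ S) :
    controlled S t hadamardMatrix ∈ ancillaOps n := by
  set d : Fin (n + 1) := Fin.natAdd n 0 with hd
  set t' : Fin (n + 1) := Fin.castAdd 1 t with ht'
  set S' : Finset (Fin (n + 1)) := S.map (Fin.castAddEmb 1) with hS'
  have hdt : d ≠ t' := (castAdd_ne_natAdd t 0).symm
  have htS : t' ∉ S' := castAdd_notMem_map h
  have hdS : d ∉ S' := natAdd_notMem_map S 0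
  have hF : controlled S' d notMatrix ∈ circuitOps (n + 1) :=
    controlled_not_mem _ S' d t' le_rfl hdS htS hdt.symm
  refine ⟨_, mul_mem (mul_mem hF (controlled_hadamard_mem₁ hdt)) hF, fun ψ => ?_⟩
  rw [← controlled_mulVec_tensorVec]
  funext x
  change _ = (controlled S' t' hadamardMatrix *ᵥ _) x
  rw [← mulVec_mulVec, ← mulVec_mulVec, controlled_not_mulVec, controlled_mulVec {d} t',
    controlled_mulVec S' t']
  simp only [controlled_not_mulVec, flip_update_flip htS hdS hdt, flip_flip hdS,
    Finset.mem_singleton, forall_eq, flip_apply_of_ne _ hdt.symm, flip_apply_self]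
  -- On rows with ancilla 0, the flipped ancilla is exactly the conjunction; on rows with ancilla 1,
  -- both sides vanish.
  rcases Fin.exists_fin_two.1 ⟨x d, rfl⟩ with hx | hx
  · by_cases hc : ∀ j ∈ S', x j = 1
    · simp only [if_pos hc, hx, zero_add, if_true]
    · simp only [if_neg hc, hx, zero_ne_one, if_false]
  · have h0 : ∀ b, tensorVec ψ (ketZero 1) (Function.update x t' b) = 0 := fun b => by
      rw [tensorVec_ketZero_one, ← hd, Function.update_of_ne hdt, hx]
      rfl
    have h0' : tensorVec ψ (ketZero 1) x = 0 := by
      rw [tensorVec_ketZero_one, ← hd, hx]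
      rfl
    simp only [h0, h0', mul_zero, Finset.sum_const_zero, ite_self]

theorem controlled_empty_mul {N : ℕ} (t : Fin N) (A B : Matrix (Fin 2) (Fin 2) ℂ) :
    controlled ∅ t A * controlled ∅ t B = controlled ∅ t (A * B) := by
  refine matrix_ext_mulVec fun v x => ?_
  rw [← mulVec_mulVec]
  simp only [controlled_mulVec, Finset.notMem_empty, false_imp_iff, implies_true, if_true,
    Function.update_self, Function.update_idem, Fin.sum_univ_two, mul_apply]
  ring

/-- XHXHX = XZX = diag(−1, 1), applied to the ancilla, negates |0⟩. This covers n = 0, where no pair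
of basis states is available. -/
theorem neg_one_mem_ancillaOps (n : ℕ) : -1 ∈ ancillaOps n := by
  have hX := controlled_not_mem₀ (Fin.natAdd n (0 : Fin 1))
  have hH := controlled_hadamard_mem₀ (Fin.natAdd n (0 : Fin 1))
  have h := mul_mem (mul_mem (mul_mem (mul_mem hX hH) hX) hH) hX
  have hprod : notMatrix * hadamardMatrix * notMatrix * hadamardMatrix * notMatrix
      = !![-1, 0; 0, 1] := by
    have h2 := sqrtTwo_mul_self
    have h0 := sqrtTwo_ne_zero
    ext i j
    fin_cases i <;> fin_cases j <;>
      simp [notMatrix, hadamardMatrix, mul_apply, Fin.sum_univ_two] <;> field_simp <;>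
      rw [sq, sqrtTwo_mul_self] <;> norm_num
  simp only [controlled_empty_mul, hprod] at h
  refine ⟨_, h, fun ψ => ?_⟩
  funext x
  rw [controlled_mulVec]
  simp only [tensorVec_ketZero_one, Finset.notMem_empty, false_imp_iff, implies_true, if_true,
    Function.update_self, Fin.sum_univ_two, neg_mulVec, one_mulVec]
  have hl : ∀ b, left (Function.update x (Fin.natAdd n 0) b) = left x := fun b => by
    funext i
    exact Function.update_of_ne (castAdd_ne_natAdd i 0) _ _
  rcases Fin.exists_fin_two.1 ⟨x (Fin.natAdd n 0), rfl⟩ with hx | hx <;> simp [hx, hl]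

/-! ### All one- and two-level matrices -/

section Conj

variable {ι : Type*} [Fintype ι] [DecidableEq ι]

/-- The permutations whose matrices, and those of their inverses, lie in a submonoid. -/
def permSubgroup (G : Submonoid (Matrix ι ι ℂ)) : Subgroup (Equiv.Perm ι) where
  carrier := {σ | σ.permMatrix ℂ ∈ G ∧ (σ⁻¹).permMatrix ℂ ∈ G}
  one_mem' := by simp [one_mem]
  mul_mem' := by
    rintro σ τ ⟨h1, h2⟩ ⟨h3, h4⟩
    refine ⟨?_, ?_⟩
    · rw [permMatrix_mul]
      exact mul_mem h3 h1
    · rw [_root_.mul_inv_rev, permMatrix_mul]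
      exact mul_mem h2 h4
  inv_mem' := fun {σ} h => ⟨h.2, by rw [inv_inv]; exact h.1⟩

variable {G : Submonoid (Matrix ι ι ℂ)}

/-- Relabelling coordinates by conjugation; since `permMatrix` acts by v ↦ v ∘ σ, the inverse stands
on the left. -/
theorem hadamardAt_perm_mem {σ : Equiv.Perm ι} (hσ : σ ∈ permSubgroup G) {a b : ι} (hab : a ≠ b)
    (h : hadamardAt a b ∈ G) : hadamardAt (σ a) (σ b) ∈ G := by
  have h' := mul_mem (mul_mem hσ.2 h) hσ.1
  convert h' using 1
  refine matrix_ext_mulVec fun v x => ?_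
  rw [hadamardAt_mulVec (σ.injective.ne hab), ← mulVec_mulVec, ← mulVec_mulVec, permMatrix_mulVec,
    permMatrix_mulVec, Function.comp, hadamardAt_mulVec hab]
  have hx : σ (σ⁻¹ x) = x := σ.apply_symm_apply x
  simp only [Equiv.Perm.inv_eq_iff_eq, Function.comp, hx]

/-- HXH = Z on the plane of a and b, with the minus sign on the second coordinate. -/
theorem signAt_eq {a b : ι} (hab : a ≠ b) :
    signAt b = hadamardAt a b * (Equiv.swap a b).permMatrix ℂ * hadamardAt a b := by
  have h0 := sqrtTwo_ne_zero
  refine matrix_ext_mulVec fun v x => ?_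
  rw [← mulVec_mulVec, ← mulVec_mulVec, signAt_mulVec, hadamardAt_mulVec hab, permMatrix_mulVec]
  simp only [Function.comp, Equiv.swap_apply_left, Equiv.swap_apply_right, hadamardAt_mulVec hab,
    if_true, if_neg hab.symm]
  by_cases h2 : x = a
  · subst h2; simp only [if_true, if_neg hab]; field_simp; rw [sq, sqrtTwo_mul_self]; ring
  by_cases h1 : x = b
  · subst h1; simp only [if_true, if_neg hab.symm]; field_simp; rw [sq, sqrtTwo_mul_self]; ring
  · rw [Equiv.swap_apply_of_ne_of_ne h2 h1]
    simp only [if_neg h2, if_neg h1]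

end Conj

/-! ### Basis states as vertices of a hypercube -/

/-- Connectedness of the hypercube: every string arises from the all-ones string `1` by flipping its
zero bits one at a time. -/
theorem bits_induction {n : ℕ} {Q : Bits n → Prop} (h1 : Q 1)
    (h : ∀ c i, Q c → Q (flip ∅ i c)) (c : Bits n) : Q c := by
  have key : ∀ T : Finset (Fin n), Q fun i => if i ∈ T then c i else 1 := by
    intro T
    induction T using Finset.induction_on with
    | empty => exact h1
    | insert a T ha ih =>
      by_cases hc : c a = 1
      · convert ih using 2 with i
        by_cases hi : i = a
        · subst hi; simp [ha, hc]
        · simp [hi]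
      · convert h _ a ih using 2 with i
        by_cases hi : i = a
        · subst hi
          have : c i = 0 := by omega
          simp [flip, ha, this]
        · simp [flip, hi]
  simpa using key Finset.univ

theorem flip_comm {n : ℕ} (i j : Fin n) (c : Bits n) :
    flip ∅ i (flip ∅ j c) = flip ∅ j (flip ∅ i c) := by
  funext k
  simp only [flip, Finset.notMem_empty, false_imp_iff, implies_true, and_true]
  split_ifs <;> rfl

/-- A gate on t controlled by all other wires acts only on the edge in direction t at the all-ones
vertex, hence is two-level. -/
theorem ctrl_all_iff {n : ℕ} (t : Fin n) (x : Bits n) :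
    (∀ i ∈ Finset.univ.erase t, x i = 1) ↔ x = flip ∅ t 1 ∨ x = 1 := by
  constructor
  · intro h
    simp only [Finset.mem_erase, Finset.mem_univ, and_true] at h
    rcases Fin.exists_fin_two.1 ⟨x t, rfl⟩ with hx | hx
    · left
      funext i
      by_cases hi : i = t
      · subst hi; simp [flip, hx]
      · simp [flip, hi, h i hi]
    · right
      funext i
      by_cases hi : i = t
      · subst hi; simp [hx]
      · simp [h i hi]
  · rintro (rfl | rfl) i hi
    · simp [flip, (Finset.mem_erase.1 hi).1]
    · rfl

theorem flip_ne {n : ℕ} (t : Fin n) (x : Bits n) : flip ∅ t x ≠ x := by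
  intro h
  have := congrFun h t
  simp [flip] at this

theorem controlled_not_eq {n : ℕ} {S : Finset (Fin n)} {t : Fin n} (h : t ∉ S) :
    controlled S t notMatrix
      = (Function.Involutive.toPerm (flip S t) (flip_flip h)).permMatrix ℂ :=
  matrix_ext_mulVec fun v x => by
    rw [controlled_not_mulVec, permMatrix_mulVec]
    rfl

theorem toPerm_flip_mem {n : ℕ} {S : Finset (Fin n)} {t : Fin n} (h : t ∉ S) :
    Function.Involutive.toPerm (flip S t) (flip_flip h) ∈ permSubgroup (ancillaOps n) := by
  have := controlled_not_mem_ancillaOps h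
  rw [controlled_not_eq h] at this
  exact ⟨this, this⟩

/-- At the all-ones vertex the edge transposition is the fully controlled NOT; conjugating by X on
single wires carries it to every parallel edge. -/
theorem swap_flip_mem {n : ℕ} (c : Bits n) (t : Fin n) :
    Equiv.swap c (flip ∅ t c) ∈ permSubgroup (ancillaOps n) := by
  induction c using bits_induction with
  | h1 =>
    convert toPerm_flip_mem (Finset.notMem_erase t Finset.univ) using 1
    ext1 x
    by_cases h : ∀ i ∈ Finset.univ.erase t, x i = 1
    · have hx : flip (Finset.univ.erase t) t x = flip ∅ t x :=
        funext fun i => if_congr (and_congr_right fun _ => iff_of_true h (by simp)) rfl rfl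
      change _ = flip (Finset.univ.erase t) t x
      rw [hx]
      rcases (ctrl_all_iff t x).1 h with rfl | rfl
      · rw [Equiv.swap_apply_right, flip_flip (Finset.notMem_empty t)]
      · rw [Equiv.swap_apply_left]
    · have hx : flip (Finset.univ.erase t) t x = x := by
        funext i
        exact if_neg fun h' => h h'.2
      change _ = flip (Finset.univ.erase t) t x
      rw [ctrl_all_iff, not_or] at h
      rw [hx, Equiv.swap_apply_of_ne_of_ne h.2 h.1]
  | h c i ih =>
    have hi := toPerm_flip_mem (Finset.notMem_empty i)
    have := mul_mem (mul_mem hi ih) (inv_mem hi)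
    rw [← Equiv.swap_apply_apply] at this
    change Equiv.swap (flip ∅ i c) (flip ∅ i (flip ∅ t c)) ∈ _ at this
    rwa [flip_comm] at this

/-- Transpositions along edges compose along paths from `1`, giving all transpositions and hence all
permutations. -/
theorem permSubgroup_ancillaOps (n : ℕ) (σ : Equiv.Perm (Bits n)) :
    σ ∈ permSubgroup (ancillaOps n) := by
  have h1 : ∀ c : Bits n, Equiv.swap 1 c ∈ permSubgroup (ancillaOps n) := by
    intro c
    induction c using bits_induction with
    | h1 =>
      rw [Equiv.swap_self]
      exact one_mem _
    | h c i ih => exact SubmonoidClass.swap_mem_trans _ ih (swap_flip_mem c i)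
  refine Equiv.Perm.swap_induction_on σ (one_mem _) fun σ a b _ h => mul_mem ?_ h
  exact SubmonoidClass.swap_mem_trans _ (Equiv.swap_comm 1 a ▸ h1 a) (h1 b)

theorem controlled_hadamard_eq {n : ℕ} (t : Fin n) :
    controlled (Finset.univ.erase t) t hadamardMatrix = hadamardAt (flip ∅ t 1) 1 := by
  refine matrix_ext_mulVec fun v x => ?_
  rw [hadamardAt_mulVec (flip_ne t 1), controlled_mulVec]
  simp only [ctrl_all_iff]
  have h0 : Function.update (1 : Bits n) t 0 = flip ∅ t 1 := by
    funext i
    by_cases hi : i = t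
    · subst hi; simp [flip]
    · simp [flip, hi]
  have h1 : Function.update (1 : Bits n) t 1 = 1 := Function.update_eq_self _ _
  by_cases hx : x = flip ∅ t 1
  · have ht : x t = 0 := by rw [hx]; simp [flip]
    have hu : ∀ b, Function.update x t b = Function.update (1 : Bits n) t b := fun b => by
      rw [hx, ← h0, Function.update_idem]
    rw [if_pos (Or.inl hx), if_pos hx, Fin.sum_univ_two, hu, hu, h0, h1, ht]
    simp [hadamardMatrix]
    ring
  · by_cases hx1 : x = 1
    · subst hx1
      rw [if_pos (Or.inr rfl), if_neg hx, if_pos rfl, Fin.sum_univ_two, h0, h1]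
      simp [hadamardMatrix]
      ring
    · rw [if_neg (not_or.2 ⟨hx, hx1⟩), if_neg hx, if_neg hx1]

theorem hadamardAt_mem_ancillaOps {n : ℕ} {a b : Bits n} (hab : a ≠ b) :
    hadamardAt a b ∈ ancillaOps n := by
  obtain ⟨t, -⟩ := Function.ne_iff.1 hab
  have h := controlled_hadamard_mem_ancillaOps (Finset.notMem_erase t Finset.univ)
  rw [controlled_hadamard_eq] at h
  have hne := flip_ne t 1
  have hs : Equiv.swap (flip ∅ t 1) a 1 ≠ a := fun h' =>
    hne ((Equiv.swap (flip ∅ t 1) a).injective (by rw [Equiv.swap_apply_left, h']))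
  -- The first swap takes the edge's endpoint `flip ∅ t 1` to a; the second takes the image of `1`
  -- to b and fixes a.
  have h' := hadamardAt_perm_mem (permSubgroup_ancillaOps n
    (Equiv.swap (Equiv.swap (flip ∅ t 1) a 1) b * Equiv.swap (flip ∅ t 1) a)) hne h
  rwa [Equiv.Perm.mul_apply, Equiv.Perm.mul_apply, Equiv.swap_apply_left, Equiv.swap_apply_left,
    Equiv.swap_apply_of_ne_of_ne hs.symm hab] at h'

theorem signAt_mem_ancillaOps {n : ℕ} (a : Bits n) : signAt a ∈ ancillaOps n := by
  rcases Nat.eq_zero_or_pos n with rfl | hn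
  · convert neg_one_mem_ancillaOps 0 using 1
    refine matrix_ext_mulVec fun v x => ?_
    rw [signAt_mulVec, if_pos (Subsingleton.elim _ _), neg_mulVec, one_mulVec]
    rfl
  · have hne := flip_ne ⟨0, hn⟩ a
    rw [signAt_eq hne]
    exact mul_mem (mul_mem (hadamardAt_mem_ancillaOps hne) (permSubgroup_ancillaOps n _).1)
      (hadamardAt_mem_ancillaOps hne)

theorem representableWith_one {n : ℕ} {V : Op n} (hV : V ∈ unitaryRing (Bits n)) :
    RepresentableWith realGates 1 V := by
  obtain ⟨A, ⟨C, rfl⟩, hA⟩ := unitaryRing_le (fun a b => (permSubgroup_ancillaOps n _).1)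
    (fun a b => hadamardAt_mem_ancillaOps) signAt_mem_ancillaOps hV
  exact ⟨C, fun ψ _ => hA ψ⟩

end

end QCirc

theorem mainTheorem2 (n : ℕ) (V : QCirc.Op n) :
    (QCirc.Representable QCirc.realGates V ↔ V ∈ QCirc.unitaryOver QCirc.ringZInvSqrtTwo n) ∧
      (V ∈ QCirc.unitaryOver QCirc.ringZInvSqrtTwo n →
        QCirc.RepresentableWith QCirc.realGates 1 V) :=
  ⟨⟨fun h => h.mem_unitaryRing, fun h => ⟨1, QCirc.representableWith_one h⟩⟩,
    fun h => QCirc.representableWith_one h⟩
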